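/- Let $S$ be a closed connected oriented polyhedral surface of genus $g\ge 1$ with a geodesic triangulation $T$, i.e. $S$ is glued from finitely many flat (nondegenerate Euclidean) triangles along their sides by isometries compatible with the orientations (loops and multiple edges are allowed). Let $T^0$ be the set of vertices and $\vec T^1$ the set of oriented edges; $-e$ denotes the edge $e$ with reversed orientation and $h_e$ its head. For an edge $e$ put $c(e)=\tfrac12\cot\alpha_e+\tfrac12\cot\beta_e$, where $\alpha_e,\beta_e$ are the angles opposite to $e$ in the two triangles adjacent to $e$. A *discrete Abelian differential of the third kind* is a map $\omega\colon\vec T^1\to\mathbb R$ with $\omega(-e)=-\omega(e)$ for all $e$. Its residue at a face is the sum of the values of $\omega$ on the counterclockwise oriented boundary edges of the face; its residue at a vertex $z$ is $\mathrm{res}_z\,\omega=i\sum_{e\in\vec T^1:\,h_e=z}c(e)\,\omega(e)$. The integral of $\omega$ along a path in the graph of edges is the sum of its values on the oriented edges of the path. The integral of $\omega$ along a chain of triangles, in which one passes from each triangle to the next one through a common side, is the sum of $c(e)\,\omega(e)$ over the sides $e$ passed through, each taken with the orientation induced from the counterclockwise boundary of the triangle being left. Fix closed paths $\alpha_1,\dots,\alpha_g,\beta_1,\dots,\beta_g$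 in the graph of edges, with a common base point, forming a standard basis of the fundamental group of $S$, i.e. generating it and such that $\alpha_1\beta_1\alpha_1^{-1}\beta_1^{-1}\cdots\alpha_g\beta_g\alpha_g^{-1}\beta_g^{-1}$ is null-homotopic. Fix also closed chains of triangles $\gamma_1,\dots,\gamma_g$ such that $\gamma_k$ is freely homotopic to $\alpha_k$ for each $k$. The *real* and the *imaginary $A$-periods* of $\omega$ are its integrals along $\alpha_1,\dots,\alpha_g$ and along $\gamma_1,\dots,\gamma_g$, respectively. Then for any two distinct vertices $z,w\in T^0$ there is a unique discrete Abelian differential $\omega$ of the third kind such that $\mathrm{res}_z\,\omega=i$, $\mathrm{res}_w\,\omega=-i$, the residues of $\omega$ at all the other vertices and at all the faces vanish, and all the real and all the imaginary $A$-periods of $\omega$ vanish. -/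

import Mathlib

/-- A closed connected oriented polyhedral surface together with a geodesic triangulation, given by
its gluing data. The elements of `D` are the oriented edges. `rev e` is the edge `e` with the
opposite orientation. Each `e` is a side of exactly one flat triangle lying to its left, and
`e, next e, next (next e)` are the consecutive sides of that triangle in counterclockwise order.
The surface is obtained from Euclidean triangles with side lengths `len` by gluing each side `e` of
one triangle to the side `rev e` of another (possibly the same) triangle by the
orientation-reversing isometry. As usual for triangulated surfaces obtained by gluing, loops and
multiple edges are allowed. -/
structure PolyhedralSurface (D : Type*) where
  rev : Equiv.Perm D
  next : Equiv.Perm D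
  rev_rev : ∀ e, rev (rev e) = e
  rev_ne : ∀ e, rev e ≠ e
  next_next_next : ∀ e, next (next (next e)) = e
  next_ne : ∀ e, next e ≠ e
  connected : ∀ e e' : D, ∃ σ ∈ Subgroup.closure {rev, next}, σ e = e'
  len : D → ℝ
  len_pos : ∀ e, 0 < len e
  len_rev : ∀ e, len (rev e) = len e
  len_lt : ∀ e, len e < len (next e) + len (next (next e))

namespace PolyhedralSurface

variable {D : Type*} (T : PolyhedralSurface D)

/-- Rotation about the tail: `next (rev e)` has the same tail as `e` and is the next edge
when one goes around this vertex. -/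
def rot : Equiv.Perm D := T.next * T.rev

/-- Vertices: classes of oriented edges with a common tail. -/
def Vertex : Type _ := Quotient (Equiv.Perm.SameCycle.setoid T.rot)

/-- Faces: classes of oriented edges with a common left shore. -/
def Face : Type _ := Quotient (Equiv.Perm.SameCycle.setoid T.next)

/-- Non-oriented edges. -/
def Edge : Type _ := Quotient (Equiv.Perm.SameCycle.setoid T.rev)

def tail (e : D) : T.Vertex := Quotient.mk _ e

def head (e : D) : T.Vertex := T.tail (T.rev e)

/-- The left shore. -/
def left (e : D) : T.Face := Quotient.mk _ e

/-- The right shore. -/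
def right (e : D) : T.Face := T.left (T.rev e)

theorem tail_next (e : D) : T.tail (T.next e) = T.head e := by
  refine Quotient.sound (Equiv.Perm.SameCycle.symm ⟨1, ?_⟩)
  simp [rot, T.rev_rev]

/-- The genus of a closed connected oriented surface, through the Euler characteristic. -/
def HasGenus (g : ℕ) : Prop :=
  (Nat.card T.Vertex : ℤ) - Nat.card T.Edge + Nat.card T.Face = 2 - 2 * g

/-! ### Metric: angles and cotangent weights -/

/-- The angle opposite to the side `e` in the triangle to the left of `e` (law of cosines). -/
noncomputable def oppositeAngle (e : D) : ℝ :=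
  Real.arccos ((T.len (T.next e) ^ 2 + T.len (T.next (T.next e)) ^ 2 - T.len e ^ 2) /
    (2 * T.len (T.next e) * T.len (T.next (T.next e))))

/-- The cotangent weight of an edge. -/
noncomputable def weight (e : D) : ℝ :=
  1 / 2 * Real.cot (T.oppositeAngle e) + 1 / 2 * Real.cot (T.oppositeAngle (T.rev e))

/-! ### Paths along the edges and the fundamental group -/

/-- `T.IsWalk x p y`: the list `p` of oriented edges is a path from `x` to `y`. -/
def IsWalk (x : T.Vertex) : List D → T.Vertex → Prop
  | [], y => x = y
  | e :: p, y => T.tail e = x ∧ IsWalk (T.head e) p y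

/-- The inverse path. -/
def inv (p : List D) : List D := (p.map T.rev).reverse

/-- Homotopy, with fixed endpoints, of paths along the edges: the equivalence relation generated by
removing a passage along an edge and immediately back, and by removing a passage around a face. -/
inductive Homotopic (x y : T.Vertex) : List D → List D → Prop
  | refl (p : List D) : T.IsWalk x p y → Homotopic x y p p
  | symm {p q : List D} : Homotopic x y p q → Homotopic x y q p
  | trans {p q r : List D} : Homotopic x y p q → Homotopic x y q r → Homotopic x y p r
  | edge (p q : List D) (e : D) : T.IsWalk x (p ++ [e, T.rev e] ++ q) y → T.IsWalk x (p ++ q) y →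
      Homotopic x y (p ++ [e, T.rev e] ++ q) (p ++ q)
  | face (p q : List D) (e : D) : T.IsWalk x (p ++ [e, T.next e, T.next (T.next e)] ++ q) y →
      T.IsWalk x (p ++ q) y →
      Homotopic x y (p ++ [e, T.next e, T.next (T.next e)] ++ q) (p ++ q)

/-- The closed paths `α₁, …, α_g, β₁, …, β_g` based at `x` form a standard basis of the
fundamental group: they generate it, and `α₁β₁α₁⁻¹β₁⁻¹ ⋯ α_gβ_gα_g⁻¹β_g⁻¹` is null-homotopic. -/
structure IsStandardBasis {g : ℕ} (x : T.Vertex) (α β : Fin g → List D) : Prop where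
  closed_left : ∀ k, T.IsWalk x (α k) x
  closed_right : ∀ k, T.IsWalk x (β k) x
  generate : ∀ p, T.IsWalk x p x → ∃ L : List (List D),
    (∀ q ∈ L, ∃ k, q = α k ∨ q = β k ∨ q = T.inv (α k) ∨ q = T.inv (β k)) ∧
      T.Homotopic x x p L.flatten
  relation : T.Homotopic x x
    (List.ofFn fun k => α k ++ β k ++ T.inv (α k) ++ T.inv (β k)).flatten []

/-! ### Chains of triangles -/

/-- `T.IsChain f c f'`: the list `c` of oriented edges describes a chain of triangles from the
face `f` to the face `f'`; each element of `c` is the common side through which the chain passes to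
the next triangle, with the orientation induced by the triangle being left. -/
def IsChain (f : T.Face) : List D → T.Face → Prop
  | [], f' => f = f'
  | e :: c, f' => T.left e = f ∧ IsChain (T.right e) c f'

/-- Simultaneous motion of a triangle and of one of its vertices. The state `e` stands for the
triangle to the left of `e` with its marked vertex `tail e`. At each step either the triangle is
kept and the marked vertex moves along `e` to the next vertex of the triangle (`turn`), or the
marked vertex is kept and one passes to the adjacent triangle through the side `e` (`cross`). In
`T.CornerWalk d p c d'` the list `p` is the path of the marked vertex and `c` is the chain of
triangles. Vertex and triangle being incident at all times, for `d = d'` the closed path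
`p` and the closed chain `c` are freely homotopic on the surface. -/
inductive CornerWalk : D → List D → List D → D → Prop
  | nil (d : D) : CornerWalk d [] [] d
  | turn {e d' : D} {p c : List D} : CornerWalk (T.next e) p c d' → CornerWalk e (e :: p) c d'
  | cross {e d' : D} {p c : List D} :
      CornerWalk (T.next (T.rev e)) p c d' → CornerWalk e p (e :: c) d'

/-- The closed chain of triangles `c` is freely homotopic to the closed path `a` based at `x`:
some closed path `p` accompanying the chain is, after conjugation by a path `b`,
homotopic to `a`. -/
def ChainHomotopic (x : T.Vertex) (c a : List D) : Prop :=
  ∃ (d : D) (p b : List D), T.CornerWalk d p c d ∧ T.IsWalk x b (T.tail d) ∧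
    T.Homotopic x x (b ++ p ++ T.inv b) a

/-! ### Discrete Abelian differentials of the third kind -/

/-- Discrete Abelian differentials of the third kind. -/
def IsAbelianDifferential (ω : D → ℝ) : Prop := ∀ e, ω (T.rev e) = -ω e

/-- The integral along a path in the graph of edges. -/
def pathIntegral (ω : D → ℝ) (p : List D) : ℝ := (p.map ω).sum

/-- The integral along a chain of triangles. -/
noncomputable def chainIntegral (ω : D → ℝ) (c : List D) : ℝ :=
  (c.map fun e => T.weight e * ω e).sum

open Classical in
/-- The residue at a face: the counterclockwise integral along its boundary. -/
noncomputable def faceResidue [Fintype D] (ω : D → ℝ) (f : T.Face) : ℂ :=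
  ((∑ e with T.left e = f, ω e : ℝ) : ℂ)

open Classical in
/-- The residue at a vertex. -/
noncomputable def vertexResidue [Fintype D] (ω : D → ℝ) (z : T.Vertex) : ℂ :=
  Complex.I * ((∑ e with T.head e = z, T.weight e * ω e : ℝ) : ℂ)

end PolyhedralSurface

/-! ### Linear algebra -/

/-! The conditions form a linear system whose unknowns are the values of `ω` on the `E` non-oriented
edges. Every edge enters with both orientations, so the face residues add up to zero, and so do the
vertex residues. The data thus range over a space of dimension `F + V + 2g - 2`, which equals `E` by
Euler's formula, and existence follows from uniqueness for the homogeneous system.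

For uniqueness let all the data vanish. Then `ω` is closed, and `c ω` sums to zero around every
vertex, so it corresponds to a closed form `b` whose integrals along the `α k` are the imaginary
`A`-periods of `ω` (`IsAbelianDifferential.exists_isClosedForm`). The energy `∑ c ω²` equals minus
the cup product of `ω` and `b`. By the Riemann bilinear identity
(`IsStandardBasis.exists_bilinear_identity`) a nonzero multiple of this cup product is a sum of
products of periods, each containing an `A`-period; hence the energy vanishes. Single weights may be
negative, but the energy of a closed form is positive definite on each triangle (`triangle_energy`),
so `ω = 0`.

The bilinear identity is proved without cutting the surface: an iterated integral is followed along
the null-homotopy of the product of commutators. The resulting factor is the degree with which the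
homotopy covers a triangle. Only its nonvanishing matters, and this is tested on forms with
prescribed periods. -/

/-- Exactness by dimension count: `range f ≤ ker φ`, and `h` forces equal dimensions. It turns an
upper bound on a kernel into solvability. -/
theorem LinearMap.exists_of_finrank_le {A B C : Type*} [AddCommGroup A] [Module ℝ A]
    [FiniteDimensional ℝ A] [AddCommGroup B] [Module ℝ B] [FiniteDimensional ℝ B]
    [AddCommGroup C] [Module ℝ C] [FiniteDimensional ℝ C] (f : A →ₗ[ℝ] B) (φ : B →ₗ[ℝ] C)
    (hφ : Function.Surjective φ) (hφf : ∀ a, φ (f a) = 0)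
    (h : Module.finrank ℝ B + Module.finrank ℝ (LinearMap.ker f) ≤
      Module.finrank ℝ A + Module.finrank ℝ C) (b : B) (hb : φ b = 0) : ∃ a, f a = b := by
  have h1 := f.finrank_range_add_finrank_ker
  have h2 := φ.finrank_range_add_finrank_ker
  rw [LinearMap.range_eq_top.2 hφ, finrank_top] at h2
  have h3 : LinearMap.range f = LinearMap.ker φ := by
    apply Submodule.eq_of_le_of_finrank_le
    · rintro _ ⟨a, rfl⟩
      exact hφf a
    · omega
  have : b ∈ LinearMap.range f := by
    rw [h3]
    exact hb
  exact this

open Classical in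
/-- Summation over the fibers of a map. -/
noncomputable def fiberSum {ι κ : Type*} [Fintype ι] (f : ι → κ) : (ι → ℝ) →ₗ[ℝ] (κ → ℝ) where
  toFun u y := ∑ e with f e = y, u e
  map_add' u v := by
    ext y
    simp [Finset.sum_add_distrib]
  map_smul' r u := by
    ext y
    simp [Finset.mul_sum]

theorem fiberSum_apply {ι κ : Type*} [Fintype ι] (f : ι → κ) (u : ι → ℝ) (y : κ)
    [DecidablePred fun e => f e = y] : fiberSum f u y = ∑ e with f e = y, u e := by
  simp only [fiberSum, LinearMap.coe_mk, AddHom.coe_mk]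
  congr!

theorem sum_fiberSum {ι κ : Type*} [Fintype ι] [Fintype κ] (f : ι → κ) (u : ι → ℝ) :
    ∑ y, fiberSum f u y = ∑ e, u e := by
  classical
  simp only [fiberSum_apply]
  exact Finset.sum_fiberwise Finset.univ f u

/-- The sum of all the values, as a linear form. -/
def totalSum (κ : Type*) [Fintype κ] : (κ → ℝ) →ₗ[ℝ] ℝ := ∑ y, LinearMap.proj y

theorem totalSum_apply {κ : Type*} [Fintype κ] (u : κ → ℝ) : totalSum κ u = ∑ y, u y := by
  simp [totalSum]

theorem totalSum_surjective (κ : Type*) [Fintype κ] [Nonempty κ] :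
    Function.Surjective (totalSum κ) := by
  classical
  intro r
  obtain ⟨y⟩ := ‹Nonempty κ›
  exact ⟨Pi.single y r, by simp [totalSum_apply]⟩

/-- A function whose sum over each cycle of a permutation vanishes is a difference. -/
theorem Equiv.Perm.exists_sub_eq {D : Type*} [Fintype D] (σ : Equiv.Perm D) (η : D → ℝ)
    (hη : ∀ y, fiberSum (Quotient.mk (Equiv.Perm.SameCycle.setoid σ)) η y = 0) :
    ∃ h : D → ℝ, ∀ d, h (σ d) - h d = η d := by
  classical
  let s := Equiv.Perm.SameCycle.setoid σ
  have : Fintype (Quotient s) := Fintype.ofFinite _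
  let f : (D → ℝ) →ₗ[ℝ] (D → ℝ) := LinearMap.funLeft ℝ ℝ σ - LinearMap.id
  have hf : ∀ h d, f h d = h (σ d) - h d := fun h d => rfl
  have h1 : Function.Surjective (fiberSum (ι := D) (Quotient.mk s)) := by
    intro u
    refine ⟨fun d => if d = (Quotient.mk s d).out then u (Quotient.mk s d) else 0, ?_⟩
    ext y
    rw [fiberSum_apply, Finset.sum_eq_single y.out]
    · simp
    · intro d hd hne
      rw [Finset.mem_filter] at hd
      rw [hd.2, if_neg hne]
    · simp
  have h2 : ∀ h, fiberSum (Quotient.mk s) (f h) = 0 := by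
    intro h
    ext y
    rw [fiberSum_apply]
    simp only [hf, Finset.sum_sub_distrib]
    rw [Pi.zero_apply, sub_eq_zero]
    refine Finset.sum_equiv σ (fun d => ?_) fun _ _ => rfl
    have : Quotient.mk s (σ d) = Quotient.mk s d :=
      Quotient.sound (Equiv.Perm.SameCycle.symm ⟨1, by simp⟩)
    simp [this]
  -- The kernel consists of functions constant on cycles, which are determined by their values at
  -- the representatives.
  have h3 : Module.finrank ℝ (LinearMap.ker f) ≤ Module.finrank ℝ (Quotient s → ℝ) := by
    apply LinearMap.finrank_le_finrank_of_injective
      (f := (LinearMap.funLeft ℝ ℝ (Quotient.out : Quotient s → D)).comp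
        (LinearMap.ker f).subtype)
    rw [← LinearMap.ker_eq_bot, LinearMap.ker_eq_bot']
    rintro ⟨h, hk⟩ h0
    have hinv : ∀ d, h (σ d) = h d := fun d => by
      have := congrFun (LinearMap.mem_ker.1 hk) d
      rw [hf] at this
      exact sub_eq_zero.1 this
    have hz : ∀ (n : ℤ) d, h ((σ ^ n) d) = h d := by
      intro n
      induction n using Int.induction_on with
      | zero => simp
      | succ i ih => intro d; rw [zpow_add_one, Equiv.Perm.mul_apply, ih, hinv]
      | pred i ih =>
        intro d
        rw [zpow_sub_one, Equiv.Perm.mul_apply, ih, ← hinv]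
        exact congrArg h (σ.apply_symm_apply d)
    ext d
    have hd : s (Quotient.mk s d).out d := Quotient.mk_out d
    obtain ⟨n, hn⟩ := hd
    have := congrFun h0 (Quotient.mk s d)
    simp only [LinearMap.comp_apply, LinearMap.funLeft_apply, Submodule.subtype_apply,
      Pi.zero_apply] at this
    change h d = 0
    rw [← hn, hz]
    exact this
  obtain ⟨h, hh⟩ := LinearMap.exists_of_finrank_le f (fiberSum (Quotient.mk s)) h1 h2
    (by omega) η (funext hη)
  exact ⟨h, fun d => by rw [← hf, hh]⟩

/-! ### Positivity of the cotangent weights -/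

theorem Real.cot_arccos (u : ℝ) : Real.cot (Real.arccos u) = u / √(1 - u ^ 2) := by
  by_cases h : u ∈ Set.Icc (-1) 1
  · rw [Real.cot_eq_cos_div_sin, Real.sin_arccos, Real.cos_arccos h.1 h.2]
  -- Outside `[-1, 1]` both denominators are zero, so both sides take the default value of division
  -- by zero.
  · have h0 : √(1 - u ^ 2) = 0 := by
      apply Real.sqrt_eq_zero_of_nonpos
      by_contra hc
      exact h (abs_le.1 (abs_le_one_iff_mul_self_le_one.2 (by nlinarith)))
    rw [Real.cot_eq_cos_div_sin, Real.sin_arccos, h0, div_zero, div_zero]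

/-- For a triangle `K` is 16 times the squared area. It is symmetric in the sides, so the three
cotangents share the denominator `√K`. -/
theorem Real.cot_arccos_law_of_cosines {a b c K : ℝ} (hb : 0 < b) (hc : 0 < c)
    (hK : K = 4 * b ^ 2 * c ^ 2 - (b ^ 2 + c ^ 2 - a ^ 2) ^ 2) :
    Real.cot (Real.arccos ((b ^ 2 + c ^ 2 - a ^ 2) / (2 * b * c))) =
      (b ^ 2 + c ^ 2 - a ^ 2) / √K := by
  have h : 1 - ((b ^ 2 + c ^ 2 - a ^ 2) / (2 * b * c)) ^ 2 = K / (2 * b * c) ^ 2 := by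
    rw [hK]
    field_simp
    ring
  rw [Real.cot_arccos, h, Real.sqrt_div' _ (by positivity), Real.sqrt_sq (by positivity)]
  have : 2 * b * c ≠ 0 := by positivity
  rw [div_div_div_cancel_right₀ this]

/-- An obtuse angle gives a negative term, so positivity holds only on the plane `x + y + z = 0`.
Vanishing of `y` and `z` follows by cyclic symmetry. -/
theorem triangle_energy {a b c : ℝ} (ha : 0 < a) (hb : 0 < b) (hc : 0 < c) (h1 : a < b + c)
    (h2 : b < c + a) (h3 : c < a + b) {x y z : ℝ} (hxyz : x + y + z = 0) :
    0 ≤ Real.cot (Real.arccos ((b ^ 2 + c ^ 2 - a ^ 2) / (2 * b * c))) * x ^ 2 +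
      Real.cot (Real.arccos ((c ^ 2 + a ^ 2 - b ^ 2) / (2 * c * a))) * y ^ 2 +
      Real.cot (Real.arccos ((a ^ 2 + b ^ 2 - c ^ 2) / (2 * a * b))) * z ^ 2 ∧
    (Real.cot (Real.arccos ((b ^ 2 + c ^ 2 - a ^ 2) / (2 * b * c))) * x ^ 2 +
      Real.cot (Real.arccos ((c ^ 2 + a ^ 2 - b ^ 2) / (2 * c * a))) * y ^ 2 +
      Real.cot (Real.arccos ((a ^ 2 + b ^ 2 - c ^ 2) / (2 * a * b))) * z ^ 2 = 0 → x = 0) := by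
  obtain ⟨K, hK⟩ : ∃ K, K = 4 * b ^ 2 * c ^ 2 - (b ^ 2 + c ^ 2 - a ^ 2) ^ 2 := ⟨_, rfl⟩
  have hK0 : 0 < K := by
    -- Heron's formula.
    have : K = (a + b + c) * (b + c - a) * (c + a - b) * (a + b - c) := by rw [hK]; ring
    rw [this]
    have := sub_pos.2 h1
    have := sub_pos.2 h2
    have := sub_pos.2 h3
    positivity
  rw [Real.cot_arccos_law_of_cosines hb hc hK,
    Real.cot_arccos_law_of_cosines hc ha (K := K) (by rw [hK]; ring),
    Real.cot_arccos_law_of_cosines ha hb (K := K) (by rw [hK]; ring)]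
  have hs := Real.sqrt_pos.2 hK0
  have hz : z = -x - y := by linarith
  -- Eliminate `z` and complete the square in `y`.
  have e : (b ^ 2 + c ^ 2 - a ^ 2) / √K * x ^ 2 + (c ^ 2 + a ^ 2 - b ^ 2) / √K * y ^ 2 +
      (a ^ 2 + b ^ 2 - c ^ 2) / √K * z ^ 2 =
      ((2 * a ^ 2 * y + (a ^ 2 + b ^ 2 - c ^ 2) * x) ^ 2 + K * x ^ 2) / (2 * a ^ 2 * √K) := by
    rw [hz, hK]
    field_simp
    ring
  rw [e]
  refine ⟨by positivity, fun h => ?_⟩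
  rw [div_eq_zero_iff, or_iff_left (by positivity)] at h
  have h4 : K * x ^ 2 = 0 := by
    nlinarith [sq_nonneg (2 * a ^ 2 * y + (a ^ 2 + b ^ 2 - c ^ 2) * x),
      mul_nonneg hK0.le (sq_nonneg x)]
  simpa [hK0.ne'] using h4

namespace PolyhedralSurface

variable {D : Type*} (T : PolyhedralSurface D)

/-! ### Paths and integrals along them -/

theorem isWalk_append {x y : T.Vertex} {p q : List D} :
    T.IsWalk x (p ++ q) y ↔ ∃ m, T.IsWalk x p m ∧ T.IsWalk m q y := by
  induction p generalizing x with
  | nil => simp [IsWalk]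
  | cons e p ih => simp [IsWalk, ih, and_assoc]

theorem inv_cons (e : D) (p : List D) : T.inv (e :: p) = T.inv p ++ [T.rev e] := by
  simp [inv]

theorem isWalk_inv {x y : T.Vertex} {p : List D} (h : T.IsWalk x p y) :
    T.IsWalk y (T.inv p) x := by
  induction p generalizing x with
  | nil => exact Eq.symm h
  | cons e p ih =>
    rw [inv_cons, isWalk_append]
    refine ⟨T.head e, ih h.2, rfl, ?_⟩
    rw [← h.1]
    simp [IsWalk, head, T.rev_rev]

theorem exists_isWalk (x y : T.Vertex) : ∃ p, T.IsWalk x p y := by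
  have key : ∀ σ ∈ Subgroup.closure {T.rev, T.next},
      ∀ e, ∃ p, T.IsWalk (T.tail e) p (T.tail (σ e)) := by
    intro σ hσ
    induction hσ using Subgroup.closure_induction with
    | mem σ hσ =>
      intro e
      refine ⟨[e], rfl, ?_⟩
      rcases hσ with rfl | hσ
      · rfl
      · rw [Set.mem_singleton_iff.1 hσ, tail_next]
        rfl
    | one => exact fun e => ⟨[], rfl⟩
    | mul σ τ _ _ h1 h2 =>
      intro e
      obtain ⟨p, hp⟩ := h2 e
      obtain ⟨q, hq⟩ := h1 (τ e)
      exact ⟨p ++ q, T.isWalk_append.2 ⟨_, hp, hq⟩⟩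
    | inv σ _ h =>
      intro e
      obtain ⟨p, hp⟩ := h (σ⁻¹ e)
      rw [show σ (σ⁻¹ e) = e from σ.apply_symm_apply e] at hp
      exact ⟨_, T.isWalk_inv hp⟩
  obtain ⟨e, rfl⟩ := Quotient.exists_rep x
  obtain ⟨e', rfl⟩ := Quotient.exists_rep y
  obtain ⟨σ, hσ, rfl⟩ := T.connected e e'
  exact key σ hσ e

@[simp]
theorem pathIntegral_nil (a : D → ℝ) : pathIntegral a [] = 0 := rfl

@[simp]
theorem pathIntegral_cons (a : D → ℝ) (e : D) (p : List D) :
    pathIntegral a (e :: p) = a e + pathIntegral a p := by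
  simp [pathIntegral]

@[simp]
theorem pathIntegral_append (a : D → ℝ) (p q : List D) :
    pathIntegral a (p ++ q) = pathIntegral a p + pathIntegral a q := by
  simp [pathIntegral]

/-- The sum of the values on the sides of the triangle to the left. -/
def faceSum (a : D → ℝ) (e : D) : ℝ := a e + a (T.next e) + a (T.next (T.next e))

/-- Closed discrete 1-forms. -/
def IsClosedForm (a : D → ℝ) : Prop := T.IsAbelianDifferential a ∧ ∀ e, T.faceSum a e = 0

variable {T}

theorem IsAbelianDifferential.pathIntegral_inv {a : D → ℝ} (ha : T.IsAbelianDifferential a)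
    (p : List D) : pathIntegral a (T.inv p) = -pathIntegral a p := by
  induction p with
  | nil => simp [inv]
  | cons e p ih => simp [inv_cons, ih, ha e]

theorem IsClosedForm.pathIntegral_eq {a : D → ℝ} (ha : T.IsClosedForm a) {x y : T.Vertex}
    {p q : List D} (h : T.Homotopic x y p q) : pathIntegral a p = pathIntegral a q := by
  induction h with
  | refl => rfl
  | symm _ ih => exact ih.symm
  | trans _ _ h1 h2 => exact h1.trans h2
  | edge p q e => simp [ha.1 e]
  | face p q e =>
    have := ha.2 e
    simp only [faceSum] at this
    simp only [pathIntegral_append, pathIntegral_cons, pathIntegral_nil]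
    linarith

/-- A closed form with vanishing periods is exact. -/
theorem IsClosedForm.exists_potential {a : D → ℝ} (ha : T.IsClosedForm a) (x : T.Vertex)
    (h : ∀ p, T.IsWalk x p x → pathIntegral a p = 0) :
    ∃ u : T.Vertex → ℝ, ∀ e, a e = u (T.head e) - u (T.tail e) := by
  choose p hp using T.exists_isWalk x
  refine ⟨fun y => pathIntegral a (p y), fun e => ?_⟩
  have h1 := h (p (T.tail e) ++ ([e] ++ T.inv (p (T.head e)))) (T.isWalk_append.2
    ⟨_, hp _, T.isWalk_append.2 ⟨_, ⟨rfl, rfl⟩, T.isWalk_inv (hp _)⟩⟩)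
  simp only [pathIntegral_append, pathIntegral_cons, pathIntegral_nil,
    ha.1.pathIntegral_inv] at h1
  linarith

theorem IsClosedForm.pathIntegral_eq_zero {a : D → ℝ} (ha : T.IsClosedForm a) {g : ℕ}
    {x : T.Vertex} {α β : Fin g → List D} (hαβ : T.IsStandardBasis x α β)
    (hα : ∀ k, pathIntegral a (α k) = 0) (hβ : ∀ k, pathIntegral a (β k) = 0)
    {p : List D} (hp : T.IsWalk x p x) : pathIntegral a p = 0 := by
  obtain ⟨L, hL, hpL⟩ := hαβ.generate p hp
  rw [ha.pathIntegral_eq hpL]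
  clear hpL
  induction L with
  | nil => simp
  | cons q L ih =>
    rw [List.flatten_cons, pathIntegral_append, ih fun q hq => hL q (by simp [hq]), add_zero]
    obtain ⟨k, rfl | rfl | rfl | rfl⟩ := hL q (by simp)
    · exact hα k
    · exact hβ k
    · rw [ha.1.pathIntegral_inv, hα, neg_zero]
    · rw [ha.1.pathIntegral_inv, hβ, neg_zero]

/-! ### Iterated integrals and the Riemann bilinear identity -/

variable (T)

/-- The antisymmetrized iterated integral of two discrete forms. -/
def iteratedIntegral (a b : D → ℝ) : List D → ℝ
  | [] => 0
  | e :: p => a e * pathIntegral b p - b e * pathIntegral a p + iteratedIntegral a b p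

/-- The last term collects the pairs of steps with one in `p` and the other in `q`. -/
theorem iteratedIntegral_append (a b : D → ℝ) (p q : List D) :
    iteratedIntegral a b (p ++ q) = iteratedIntegral a b p + iteratedIntegral a b q +
      (pathIntegral a p * pathIntegral b q - pathIntegral b p * pathIntegral a q) := by
  induction p with
  | nil => simp [iteratedIntegral]
  | cons e p ih =>
    simp only [List.cons_append, iteratedIntegral, ih, pathIntegral_append, pathIntegral_cons]
    ring

variable {T} in
theorem IsAbelianDifferential.iteratedIntegral_inv {a b : D → ℝ}
    (ha : T.IsAbelianDifferential a) (hb : T.IsAbelianDifferential b) (p : List D) :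
    iteratedIntegral a b (T.inv p) = -iteratedIntegral a b p := by
  induction p with
  | nil => simp [inv, iteratedIntegral]
  | cons e p ih =>
    simp only [inv_cons, iteratedIntegral_append, iteratedIntegral, ih, ha.pathIntegral_inv,
      hb.pathIntegral_inv, pathIntegral_cons, pathIntegral_nil, ha e, hb e]
    ring

/-- The exterior product of two closed forms, evaluated at the triangle to the left. -/
def wedge (a b : D → ℝ) (e : D) : ℝ := a e * b (T.next e) - a (T.next e) * b e

/-- The integral of the exterior product over the surface. -/
noncomputable def cup [Fintype D] (a b : D → ℝ) : ℝ := ∑ e, T.wedge a b e / 3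

variable {T} in
-- Closedness makes `wedge` equal on all three sides of a triangle, which explains the factor `1 /
-- 3` in `cup`.
theorem IsClosedForm.faceSum_wedge {a b : D → ℝ} (ha : T.IsClosedForm a) (hb : T.IsClosedForm b)
    (e : D) : T.faceSum (fun e => T.wedge a b e / 3) e = T.wedge a b e := by
  have h1 := ha.2 e
  have h2 := hb.2 e
  simp only [faceSum] at h1 h2
  simp only [faceSum, wedge, T.next_next_next]
  rw [show a (T.next (T.next e)) = -a e - a (T.next e) by linarith,
    show b (T.next (T.next e)) = -b e - b (T.next e) by linarith]
  ring

open Classical in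
/-- The indicator function of a triangle. -/
noncomputable def faceIndicator (e₀ : D) : D → ℝ := T.faceSum (Pi.single e₀ 1)

/-- A function on the set of triangles is, up to a point mass, the differential of a discrete
1-form. -/
theorem exists_faceSum_eq [Fintype D] (e₀ : D) (u : D → ℝ) :
    ∃ ψ, T.IsAbelianDifferential ψ ∧
      ∀ e, T.faceSum ψ e = T.faceSum u e - (∑ d, u d) * T.faceIndicator e₀ e := by
  classical
  have key : ∀ σ ∈ Subgroup.closure {T.rev, T.next}, ∀ d, ∃ ψ, T.IsAbelianDifferential ψ ∧
      ∀ e, T.faceSum ψ e = T.faceIndicator (σ d) e - T.faceIndicator d e := by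
    intro σ hσ
    induction hσ using Subgroup.closure_induction with
    | mem σ hσ =>
      intro d
      rcases hσ with rfl | hσ
      -- A unit mass is carried across the edge `d` into the adjacent triangle; `next`, treated
      -- below, stays in the same triangle.
      · refine ⟨Pi.single (T.rev d) 1 - Pi.single d 1, fun e => ?_, fun e => ?_⟩
        · have h : T.rev e = d ↔ e = T.rev d :=
            ⟨fun h => by rw [← h, T.rev_rev], fun h => by rw [h, T.rev_rev]⟩
          simp [Pi.single_apply, h]
        · simp only [faceSum, faceIndicator, Pi.sub_apply]
          ring
      · rw [Set.mem_singleton_iff.1 hσ]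
        refine ⟨0, fun e => by simp, fun e => ?_⟩
        have h : ∀ x, (x = T.next d ↔ T.next (T.next x) = d) := fun x =>
          ⟨fun h => by rw [h, T.next_next_next], fun h => by rw [← h, T.next_next_next]⟩
        simp only [faceSum, faceIndicator, Pi.single_apply, h, T.next_next_next, Pi.zero_apply]
        ring
    | one => exact fun d => ⟨0, fun e => by simp, fun e => by simp [faceSum]⟩
    | mul σ τ _ _ h1 h2 =>
      intro d
      obtain ⟨ψ, hψ, h⟩ := h2 d
      obtain ⟨ψ', hψ', h'⟩ := h1 (τ d)
      refine ⟨ψ + ψ', fun e => ?_, fun e => ?_⟩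
      · simp only [Pi.add_apply, hψ e, hψ' e]
        ring
      · have := h e
        have := h' e
        simp only [faceSum, Pi.add_apply, Equiv.Perm.mul_apply] at *
        linarith
    | inv σ _ h1 =>
      intro d
      obtain ⟨ψ, hψ, h⟩ := h1 (σ⁻¹ d)
      rw [show σ (σ⁻¹ d) = d from σ.apply_symm_apply d] at h
      refine ⟨-ψ, fun e => ?_, fun e => ?_⟩
      · simp only [Pi.neg_apply, hψ e]
      · have := h e
        simp only [faceSum, Pi.neg_apply] at *
        linarith
  have key' : ∀ d, ∃ ψ, T.IsAbelianDifferential ψ ∧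
      ∀ e, T.faceSum ψ e = T.faceIndicator d e - T.faceIndicator e₀ e := fun d => by
    obtain ⟨σ, hσ, rfl⟩ := T.connected e₀ d
    exact key σ hσ e₀
  choose ψ hψ h using key'
  refine ⟨fun e => ∑ d, u d * ψ d e, fun e => ?_, fun e => ?_⟩
  · simp only [fun d => hψ d e, mul_neg, Finset.sum_neg_distrib]
  · have h1 : T.faceSum (fun e => ∑ d, u d * ψ d e) e = ∑ d, u d * T.faceSum (ψ d) e := by
      simp only [faceSum, mul_add, Finset.sum_add_distrib]
    have h2 : T.faceSum u e = ∑ d, u d * T.faceIndicator d e := by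
      simp [faceIndicator, faceSum, mul_add, Finset.sum_add_distrib, Pi.single_apply]
    rw [h1, h2, Finset.sum_mul, ← Finset.sum_sub_distrib]
    exact Finset.sum_congr rfl fun d _ => by rw [h, mul_sub]

variable {T}

/-- A passage around a triangle adds its `wedge` to the iterated integral, and `ψ` compensates this
except at the triangle of `e₀`. So `n` is the signed number of times the homotopy sweeps that
triangle. It depends on the homotopy only, hence is quantified before the forms. -/
theorem Homotopic.exists_degree (e₀ : D) {x y : T.Vertex} {p q : List D}
    (h : T.Homotopic x y p q) : ∃ n : ℝ, ∀ (a b ψ : D → ℝ) (C : ℝ), T.IsClosedForm a →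
      T.IsClosedForm b → T.IsAbelianDifferential ψ →
      (∀ e, T.faceSum ψ e = T.wedge a b e - C * T.faceIndicator e₀ e) →
      iteratedIntegral a b p - pathIntegral ψ p =
        iteratedIntegral a b q - pathIntegral ψ q + n * C := by
  induction h with
  | refl => exact ⟨0, fun a b ψ C _ _ _ _ => by ring⟩
  | symm _ ih =>
    obtain ⟨n, hn⟩ := ih
    exact ⟨-n, fun a b ψ C ha hb hψ h => by linarith [hn a b ψ C ha hb hψ h]⟩
  | trans _ _ h1 h2 =>
    obtain ⟨n, hn⟩ := h1
    obtain ⟨m, hm⟩ := h2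
    exact ⟨n + m, fun a b ψ C ha hb hψ h => by
      linarith [hn a b ψ C ha hb hψ h, hm a b ψ C ha hb hψ h]⟩
  | edge p q e =>
    refine ⟨0, fun a b ψ C ha hb hψ h => ?_⟩
    simp only [iteratedIntegral_append, pathIntegral_append, pathIntegral_cons, pathIntegral_nil,
      iteratedIntegral, ha.1 e, hb.1 e, hψ e]
    ring
  | face p q e =>
    refine ⟨T.faceIndicator e₀ e, fun a b ψ C ha hb hψ h => ?_⟩
    have h1 := ha.2 e
    have h2 := hb.2 e
    have h3 := h e
    simp only [faceSum, wedge] at h1 h2 h3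
    simp only [iteratedIntegral_append, pathIntegral_append, pathIntegral_cons, pathIntegral_nil,
      iteratedIntegral]
    rw [show a (T.next (T.next e)) = -a e - a (T.next e) by linarith,
      show b (T.next (T.next e)) = -b e - b (T.next e) by linarith]
    linarith

/-- The Riemann bilinear identity, up to a factor depending on the basis only. -/
theorem IsStandardBasis.exists_bilinear_identity [Fintype D] {g : ℕ} {x : T.Vertex}
    {α β : Fin g → List D} (hαβ : T.IsStandardBasis x α β) :
    ∃ n : ℝ, ∀ a b, T.IsClosedForm a → T.IsClosedForm b →
      2 * ∑ k, (pathIntegral a (α k) * pathIntegral b (β k) -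
        pathIntegral b (α k) * pathIntegral a (β k)) = n * T.cup a b := by
  obtain ⟨e₀, -⟩ := Quotient.exists_rep x
  obtain ⟨n, hn⟩ := hαβ.relation.exists_degree e₀
  refine ⟨n, fun a b ha hb => ?_⟩
  obtain ⟨ψ, hψ, h⟩ := T.exists_faceSum_eq e₀ fun e => T.wedge a b e / 3
  simp only [ha.faceSum_wedge hb] at h
  have h1 := hn a b ψ (T.cup a b) ha hb hψ h
  -- Integrals over commutators vanish, so `ψ` drops out and the iterated integrals of distinct
  -- commutators simply add up.
  have h2 : ∀ c, T.IsAbelianDifferential c → ∀ l : List (Fin g), pathIntegral c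
      (l.map fun k => α k ++ β k ++ T.inv (α k) ++ T.inv (β k)).flatten = 0 := by
    intro c hc l
    induction l with
    | nil => simp
    | cons k l ih =>
      rw [List.map_cons, List.flatten_cons, pathIntegral_append, ih]
      simp [hc.pathIntegral_inv]
  have h3 : ∀ l : List (Fin g), iteratedIntegral a b
      (l.map fun k => α k ++ β k ++ T.inv (α k) ++ T.inv (β k)).flatten =
      (l.map fun k => 2 * (pathIntegral a (α k) * pathIntegral b (β k) -
        pathIntegral b (α k) * pathIntegral a (β k))).sum := by
    intro l
    induction l with
    | nil => simp [iteratedIntegral]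
    | cons k l ih =>
      rw [List.map_cons, List.flatten_cons, iteratedIntegral_append, ih, h2 a ha.1, h2 b hb.1,
        List.map_cons, List.sum_cons]
      simp only [iteratedIntegral_append, pathIntegral_append, ha.1.pathIntegral_inv,
        hb.1.pathIntegral_inv, ha.1.iteratedIntegral_inv hb.1]
      ring
  rw [List.ofFn_eq_map, h2 ψ hψ, h3, ← List.ofFn_eq_map, List.sum_ofFn] at h1
  simp only [iteratedIntegral, pathIntegral_nil] at h1
  rw [Finset.mul_sum]
  linarith

end PolyhedralSurface

namespace PolyhedralSurface

variable {D : Type*} (T : PolyhedralSurface D)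

/-! ### Vertices, faces and edges -/

instance [Finite D] : Finite T.Vertex := Quotient.finite _

instance [Finite D] : Finite T.Face := Quotient.finite _

instance [Finite D] : Finite T.Edge := Quotient.finite _

theorem left_eq_iff [Fintype D] (e e' : D) :
    T.left e' = T.left e ↔ e' = e ∨ e' = T.next e ∨ e' = T.next (T.next e) := by
  constructor
  · intro h
    obtain ⟨n, hn⟩ := (Equiv.Perm.SameCycle.symm (Quotient.exact h)).exists_nat_pow_eq
    rw [← hn]
    clear hn
    induction n with
    | zero => simp
    | succ n ih =>
      rw [pow_succ', Equiv.Perm.mul_apply]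
      rcases ih with h | h | h <;> simp [h, T.next_next_next]
  · rintro (rfl | rfl | rfl)
    · rfl
    · exact Quotient.sound (Equiv.Perm.SameCycle.symm ⟨1, by simp⟩)
    · exact Quotient.sound (Equiv.Perm.SameCycle.symm ⟨2, by simp [zpow_ofNat, pow_two]⟩)

theorem fiberSum_left [Fintype D] (a : D → ℝ) (e : D) :
    fiberSum T.left a (T.left e) = T.faceSum a e := by
  classical
  have h1 : e ≠ T.next e := (T.next_ne e).symm
  have h2 : T.next e ≠ T.next (T.next e) := (T.next_ne _).symm
  have h3 : e ≠ T.next (T.next e) := fun h => T.next_ne e (by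
    nth_rewrite 1 [h]
    rw [T.next_next_next])
  have h4 : Finset.univ.filter (fun e' => T.left e' = T.left e) =
      {e, T.next e, T.next (T.next e)} := by
    ext e'
    simp [left_eq_iff]
  rw [fiberSum_apply, h4, Finset.sum_insert (by simp [h1, h3]), Finset.sum_pair h2, faceSum]
  ring

theorem fiberSum_left_eq_zero_iff [Fintype D] (a : D → ℝ) :
    fiberSum T.left a = 0 ↔ ∀ e, T.faceSum a e = 0 := by
  refine ⟨fun h e => by rw [← fiberSum_left, h, Pi.zero_apply], fun h => funext fun f => ?_⟩
  obtain ⟨e, rfl⟩ := Quotient.exists_rep f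
  exact (T.fiberSum_left a e).trans (h e)

/-- The edge with forgotten orientation. -/
def edge (e : D) : T.Edge := Quotient.mk _ e

/-- A chosen orientation of an edge. -/
noncomputable def orientation (ε : T.Edge) : D := Quotient.out ε

theorem edge_orientation (ε : T.Edge) : T.edge (T.orientation ε) = ε := Quotient.out_eq ε

theorem edge_rev (e : D) : T.edge (T.rev e) = T.edge e :=
  Quotient.sound (Equiv.Perm.SameCycle.symm ⟨1, by simp⟩)

theorem orientation_edge [Finite D] (e : D) :
    T.orientation (T.edge e) = e ∨ T.orientation (T.edge e) = T.rev e := by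
  have h : T.rev.SameCycle (T.orientation (T.edge e)) e := Quotient.exact (T.edge_orientation _)
  obtain ⟨n, hn⟩ := h.symm.exists_nat_pow_eq
  rw [← hn]
  clear hn
  induction n with
  | zero => simp
  | succ n ih =>
    rw [pow_succ', Equiv.Perm.mul_apply]
    rcases ih with h | h <;> simp [h, T.rev_rev]

open Classical in
/-- The discrete form with given values on the chosen orientations of the edges. -/
noncomputable def orientedForm : (T.Edge → ℝ) →ₗ[ℝ] (D → ℝ) where
  toFun f e := (if e = T.orientation (T.edge e) then 1 else -1) * f (T.edge e)
  map_add' _ _ := funext fun _ => mul_add _ _ _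
  map_smul' _ _ := funext fun _ => mul_left_comm _ _ _

theorem orientedForm_orientation (f : T.Edge → ℝ) (ε : T.Edge) :
    T.orientedForm f (T.orientation ε) = f ε := by
  simp [orientedForm, edge_orientation]

theorem isAbelianDifferential_orientedForm [Finite D] (f : T.Edge → ℝ) :
    T.IsAbelianDifferential (T.orientedForm f) := by
  intro e
  have h3 := T.rev_ne e
  simp only [orientedForm, LinearMap.coe_mk, AddHom.coe_mk]
  rw [edge_rev]
  rcases T.orientation_edge e with h | h <;> rw [h] <;> simp [h3, h3.symm]

/-! ### The Dirichlet energy -/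

theorem weight_rev (e : D) : T.weight (T.rev e) = T.weight e := by
  rw [weight, weight, T.rev_rev, add_comm]

/-- Multiplication by the cotangent weights. -/
noncomputable def star : (D → ℝ) →ₗ[ℝ] (D → ℝ) where
  toFun ω e := T.weight e * ω e
  map_add' _ _ := funext fun _ => mul_add _ _ _
  map_smul' _ _ := funext fun _ => mul_left_comm _ _ _

theorem star_apply (ω : D → ℝ) (e : D) : T.star ω e = T.weight e * ω e := rfl

variable {T} in
theorem IsAbelianDifferential.star {ω : D → ℝ} (hω : T.IsAbelianDifferential ω) :
    T.IsAbelianDifferential (T.star ω) := fun e => by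
  rw [star_apply, star_apply, weight_rev, hω, mul_neg]

theorem sum_faceSum [Fintype D] (a : D → ℝ) : ∑ e, T.faceSum a e = 3 * ∑ e, a e := by
  have h1 := Equiv.sum_comp T.next a
  have h2 := Equiv.sum_comp T.next fun e => a (T.next e)
  simp only [faceSum, Finset.sum_add_distrib]
  linarith

variable {T} in
theorem IsClosedForm.eq_zero_of_energy_eq_zero [Fintype D] {ω : D → ℝ} (hω : T.IsClosedForm ω)
    (h : ∑ e, ω e * T.star ω e = 0) : ω = 0 := by
  let u : D → ℝ := fun e => Real.cot (T.oppositeAngle e) * ω e ^ 2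
  have h1 : ∑ e, u e = 0 := by
    have h2 := Equiv.sum_comp T.rev u
    have h3 : ∀ e, ω e * T.star ω e = (u e + u (T.rev e)) / 2 := fun e => by
      -- Splitting each weight into its two cotangents regroups the energy by triangles.
      simp only [u, star_apply, weight, hω.1 e]
      ring
    simp only [h3] at h
    rw [← Finset.sum_div, Finset.sum_add_distrib, h2] at h
    linarith
  have key : ∀ e, 0 ≤ T.faceSum u e ∧ (T.faceSum u e = 0 → ω e = 0) := fun e => by
    have l1 := T.len_lt e
    have l2 := T.len_lt (T.next e)
    have l3 := T.len_lt (T.next (T.next e))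
    rw [T.next_next_next] at l2 l3
    have := triangle_energy (T.len_pos _) (T.len_pos _) (T.len_pos _) l1 l2 l3 (hω.2 e)
    simpa only [faceSum, u, oppositeAngle, T.next_next_next] using this
  have h4 := T.sum_faceSum u
  rw [h1, mul_zero, Finset.sum_eq_zero_iff_of_nonneg fun e _ => (key e).1] at h4
  exact funext fun e => (key e).2 (h4 e (Finset.mem_univ e))

/-! ### Forms closed around the vertices -/

variable {T} in
/-- A form closed around the vertices is homologous to a form closed around the faces. -/
theorem IsAbelianDifferential.exists_isClosedForm [Fintype D] {η : D → ℝ}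
    (hη : T.IsAbelianDifferential η) (hη0 : ∀ y, fiberSum T.head η y = 0) :
    ∃ b, T.IsClosedForm b ∧
      (∀ d p c, T.CornerWalk d p c d → pathIntegral η c = pathIntegral b p) ∧
      ∀ a, T.IsClosedForm a → ∑ e, a e * η e = -T.cup a b := by
  classical
  have htail : ∀ y, fiberSum T.tail η y = 0 := fun y => by
    have : fiberSum T.tail η y = -fiberSum T.head η y := by
      rw [fiberSum_apply, fiberSum_apply, ← Finset.sum_neg_distrib]
      refine Finset.sum_equiv T.rev (fun d => ?_) fun d _ => by rw [hη, neg_neg]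
      rw [Finset.mem_filter_univ, Finset.mem_filter_univ, head, T.rev_rev]
    rw [this, hη0, neg_zero]
  -- `h` is a function on corners, `e` being the corner at `tail e` of the triangle to its left. It
  -- grows by `η e` when the corner crosses `e` and drops by the form `b` chosen below when it turns
  -- along `e`. Its total change over a closed corner walk is zero, which equates the two integrals.
  obtain ⟨h, hh⟩ := Equiv.Perm.exists_sub_eq T.rot η htail
  have hh' : ∀ e, η e = h (T.next (T.rev e)) - h e := fun e => (hh e).symm
  refine ⟨fun e => h e - h (T.next e), ⟨fun e => ?_, fun e => ?_⟩, ?_, fun a ha => ?_⟩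
  · have h1 := hη e
    rw [hh', hh', T.rev_rev] at h1
    linarith
  · simp [faceSum, T.next_next_next]
  · have key : ∀ d p c d', T.CornerWalk d p c d' →
        pathIntegral η c = pathIntegral (fun e => h e - h (T.next e)) p + h d' - h d := by
      intro d p c d' hw
      induction hw with
      | nil => simp
      | turn _ ih =>
        rw [ih, pathIntegral_cons]
        ring
      | cross _ ih =>
        rw [pathIntegral_cons, ih, hh']
        ring
    intro d p c hw
    rw [key d p c d hw, add_sub_cancel_right]
  -- Summation by parts: reindexing by `rev` and `next`, with closedness of `a` entering through
  -- `h0`.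
  · have r := Equiv.sum_comp T.rev fun e => a e * h (T.next (T.rev e))
    have n1 := Equiv.sum_comp T.next fun e => a e * h (T.next e)
    have n2 := Equiv.sum_comp T.next fun e => a (T.next e) * h (T.next (T.next e))
    have n3 := Equiv.sum_comp T.next fun e => a e * h (T.next (T.next e))
    have n4 := Equiv.sum_comp T.next fun e => a e * h e
    have h0 : ∑ e, (a e * h e + a (T.next e) * h e + a (T.next (T.next e)) * h e) = 0 := by
      refine Finset.sum_eq_zero fun e _ => ?_
      rw [← add_mul, ← add_mul]
      exact mul_eq_zero_of_left (ha.2 e) _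
    simp only [T.rev_rev, ha.1 _, T.next_next_next, neg_mul, Finset.sum_neg_distrib] at r n1 n2 n3 n4
    simp only [Finset.sum_add_distrib] at h0
    simp only [cup, wedge, hh', mul_sub, ← Finset.sum_div, Finset.sum_sub_distrib]
    linarith

/-! ### Existence of forms with given periods -/

/-- The integrals along given paths, as a linear map. -/
def periodMap {g : ℕ} (α : Fin g → List D) : (D → ℝ) →ₗ[ℝ] (Fin g → ℝ) where
  toFun a k := pathIntegral a (α k)
  map_add' _ _ := funext fun _ => List.sum_map_add
  map_smul' _ _ := funext fun _ => List.sum_map_mul_left _ _ _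

variable {T}

theorem IsAbelianDifferential.sum_eq_zero [Fintype D] {a : D → ℝ}
    (ha : T.IsAbelianDifferential a) : ∑ e, a e = 0 := by
  have := Equiv.sum_comp T.rev a
  simp only [ha _, Finset.sum_neg_distrib] at this
  linarith

/-- The first de Rham theorem. -/
theorem IsStandardBasis.exists_isClosedForm [Fintype D] {g : ℕ} (hT : T.HasGenus g)
    {x : T.Vertex} {α β : Fin g → List D} (hαβ : T.IsStandardBasis x α β) (s t : Fin g → ℝ) :
    ∃ a, T.IsClosedForm a ∧ (∀ k, pathIntegral a (α k) = s k) ∧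
      ∀ k, pathIntegral a (β k) = t k := by
  have : Fintype T.Vertex := Fintype.ofFinite _
  have : Fintype T.Face := Fintype.ofFinite _
  have : Fintype T.Edge := Fintype.ofFinite _
  have : Nonempty T.Vertex := ⟨x⟩
  have : Nonempty T.Face := (Quotient.exists_rep x).elim fun e _ => ⟨T.left e⟩
  let f := ((fiberSum T.left).prod ((periodMap α).prod (periodMap β))).comp T.orientedForm
  let φ := (totalSum T.Face).comp (LinearMap.fst ℝ (T.Face → ℝ) ((Fin g → ℝ) × (Fin g → ℝ)))
  -- Closed forms without periods are differentials of functions on the vertices, and constants have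
  -- zero differential.
  have hker : Module.finrank ℝ (LinearMap.ker f) + 1 ≤ Fintype.card T.Vertex := by
    let G : (T.Vertex → ℝ) →ₗ[ℝ] (T.Edge → ℝ) :=
      LinearMap.funLeft ℝ ℝ (fun ε : T.Edge => T.head (T.orientation ε)) -
        LinearMap.funLeft ℝ ℝ (fun ε : T.Edge => T.tail (T.orientation ε))
    have h1 := G.finrank_range_add_finrank_ker
    have h2 : LinearMap.ker f ≤ LinearMap.range G := by
      intro c hc
      have hc' : (fiberSum T.left (T.orientedForm c),
        periodMap α (T.orientedForm c), periodMap β (T.orientedForm c)) = 0 := hc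
      simp only [Prod.mk_eq_zero, fiberSum_left_eq_zero_iff] at hc'
      have hcl : T.IsClosedForm (T.orientedForm c) :=
        ⟨T.isAbelianDifferential_orientedForm c, hc'.1⟩
      obtain ⟨u, hu⟩ := hcl.exists_potential x fun p hp =>
        hcl.pathIntegral_eq_zero hαβ (congrFun hc'.2.1) (congrFun hc'.2.2) hp
      exact ⟨u, funext fun ε => ((T.orientedForm_orientation c ε).symm.trans (hu _)).symm⟩
    have h3 : 1 ≤ Module.finrank ℝ (LinearMap.ker G) := by
      rw [Submodule.one_le_finrank_iff, Submodule.ne_bot_iff]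
      exact ⟨1, funext fun ε => sub_self (1 : ℝ), one_ne_zero⟩
    have h4 := Submodule.finrank_mono h2
    rw [Module.finrank_fintype_fun_eq_card] at h1
    omega
  obtain ⟨c, hc⟩ := LinearMap.exists_of_finrank_le f φ
    ((totalSum_surjective _).comp LinearMap.fst_surjective)
    (fun c => by
      change totalSum T.Face (fiberSum T.left (T.orientedForm c)) = 0
      rw [totalSum_apply, sum_fiberSum, (T.isAbelianDifferential_orientedForm c).sum_eq_zero])
    (by
      simp only [HasGenus, Nat.card_eq_fintype_card] at hT
      simp only [Module.finrank_prod, Module.finrank_fintype_fun_eq_card, Fintype.card_fin,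
        Module.finrank_self]
      omega) (0, s, t) (map_zero (totalSum T.Face))
  have hc' : (fiberSum T.left (T.orientedForm c),
    periodMap α (T.orientedForm c), periodMap β (T.orientedForm c)) = (0, s, t) := hc
  simp only [Prod.mk.injEq, fiberSum_left_eq_zero_iff] at hc'
  exact ⟨T.orientedForm c, ⟨T.isAbelianDifferential_orientedForm c, hc'.1⟩,
    congrFun hc'.2.1, congrFun hc'.2.2⟩

/-! ### Uniqueness and existence for given residues and `A`-periods -/

theorem IsStandardBasis.cup_eq_zero [Fintype D] {g : ℕ} (hg : 1 ≤ g) (hT : T.HasGenus g)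
    {x : T.Vertex} {α β : Fin g → List D} (hαβ : T.IsStandardBasis x α β) {a b : D → ℝ}
    (ha : T.IsClosedForm a) (hb : T.IsClosedForm b) (haα : ∀ k, pathIntegral a (α k) = 0)
    (hbα : ∀ k, pathIntegral b (α k) = 0) : T.cup a b = 0 := by
  obtain ⟨n, hn⟩ := hαβ.exists_bilinear_identity
  have hn0 : n ≠ 0 := by
    rintro rfl
    -- Forms dual to one pair `α k₀`, `β k₀` make the left side of the bilinear identity equal to 2,
    -- so the factor cannot vanish.
    let k₀ : Fin g := ⟨0, hg⟩
    obtain ⟨a', ha', ha1, ha2⟩ := hαβ.exists_isClosedForm hT (Pi.single k₀ 1) 0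
    obtain ⟨b', hb', hb1, hb2⟩ := hαβ.exists_isClosedForm hT 0 (Pi.single k₀ 1)
    have := hn a' b' ha' hb'
    simp [ha1, ha2, hb1, hb2, Pi.single_apply] at this
  have := hn a b ha hb
  simp only [haα, hbα, zero_mul, sub_self, Finset.sum_const_zero, mul_zero] at this
  exact (mul_eq_zero.1 this.symm).resolve_left hn0

theorem IsClosedForm.eq_zero_of_periods [Fintype D] {g : ℕ} (hg : 1 ≤ g) (hT : T.HasGenus g)
    {x : T.Vertex} {α β : Fin g → List D} (hαβ : T.IsStandardBasis x α β)
    {γ : Fin g → List D} (hγ : ∀ k, T.ChainHomotopic x (γ k) (α k)) {ω : D → ℝ}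
    (hω : T.IsClosedForm ω) (hv : fiberSum T.head (T.star ω) = 0)
    (hα : periodMap α ω = 0) (hγ0 : periodMap γ (T.star ω) = 0) : ω = 0 := by
  obtain ⟨b, hb, hper, hcup⟩ := hω.1.star.exists_isClosedForm (congrFun hv)
  apply hω.eq_zero_of_energy_eq_zero
  rw [hcup ω hω, hαβ.cup_eq_zero hg hT hω hb (congrFun hα) fun k => ?_, neg_zero]
  -- The conjugating path `q` cancels in the integral of `b`, so free homotopy suffices.
  obtain ⟨d, p, q, hw, -, hpq⟩ := hγ k
  have h1 := hb.pathIntegral_eq hpq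
  have h2 : pathIntegral (T.star ω) (γ k) = 0 := congrFun hγ0 k
  rw [← h1, pathIntegral_append, pathIntegral_append, hb.1.pathIntegral_inv, ← hper d p _ hw, h2]
  ring

/-- Existence and uniqueness of a discrete form with given residues and `A`-periods. -/
theorem IsStandardBasis.existsUnique_isAbelianDifferential [Fintype D] [Fintype T.Face]
    [Fintype T.Vertex] {g : ℕ} (hg : 1 ≤ g)
    (hT : T.HasGenus g) {x : T.Vertex} {α β : Fin g → List D} (hαβ : T.IsStandardBasis x α β)
    {γ : Fin g → List D} (hγ : ∀ k, T.ChainHomotopic x (γ k) (α k)) (r : T.Face → ℝ)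
    (hr : ∑ f, r f = 0) (q : T.Vertex → ℝ) (hq : ∑ y, q y = 0) (s t : Fin g → ℝ) :
    ∃! ω, T.IsAbelianDifferential ω ∧ fiberSum T.left ω = r ∧ fiberSum T.head (T.star ω) = q ∧
      periodMap α ω = s ∧ periodMap γ (T.star ω) = t := by
  have : Fintype T.Edge := Fintype.ofFinite _
  have : Nonempty T.Vertex := ⟨x⟩
  have : Nonempty T.Face := (Quotient.exists_rep x).elim fun e _ => ⟨T.left e⟩
  have uniq : ∀ ω, T.IsAbelianDifferential ω → fiberSum T.left ω = 0 →
      fiberSum T.head (T.star ω) = 0 → periodMap α ω = 0 → periodMap γ (T.star ω) = 0 → ω = 0 :=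
    fun ω h1 h2 h3 h4 h5 => IsClosedForm.eq_zero_of_periods hg hT hαβ hγ
      ⟨h1, (T.fiberSum_left_eq_zero_iff ω).1 h2⟩ h3 h4 h5
  let f := ((fiberSum T.left).prod (((fiberSum T.head).comp T.star).prod
    ((periodMap α).prod ((periodMap γ).comp T.star)))).comp T.orientedForm
  have hf : ∀ c, f c = (fiberSum T.left (T.orientedForm c),
    fiberSum T.head (T.star (T.orientedForm c)), periodMap α (T.orientedForm c),
    periodMap γ (T.star (T.orientedForm c))) := fun c => rfl
  -- The two relations among the data: total face residue and total vertex residue. They account for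
  -- the 2 in Euler's formula.
  let φ : ((T.Face → ℝ) × (T.Vertex → ℝ) × (Fin g → ℝ) × (Fin g → ℝ)) →ₗ[ℝ] ℝ × ℝ :=
    (totalSum T.Face).prodMap ((totalSum T.Vertex).comp (LinearMap.fst ℝ _ _))
  have hker : Module.finrank ℝ (LinearMap.ker f) = 0 := by
    rw [Submodule.finrank_eq_zero, LinearMap.ker_eq_bot']
    intro c hc
    simp only [hf, Prod.mk_eq_zero] at hc
    have h0 := uniq _ (T.isAbelianDifferential_orientedForm c) hc.1 hc.2.1 hc.2.2.1 hc.2.2.2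
    exact funext fun ε => by rw [← T.orientedForm_orientation c, h0, Pi.zero_apply, Pi.zero_apply]
  obtain ⟨c, hc⟩ := LinearMap.exists_of_finrank_le f φ
    ((totalSum_surjective _).prodMap ((totalSum_surjective _).comp LinearMap.fst_surjective))
    (fun c => by
      have hc := T.isAbelianDifferential_orientedForm c
      change (totalSum T.Face (fiberSum T.left (T.orientedForm c)),
        totalSum T.Vertex (fiberSum T.head (T.star (T.orientedForm c)))) = 0
      rw [totalSum_apply, totalSum_apply, sum_fiberSum, sum_fiberSum, hc.sum_eq_zero,
        hc.star.sum_eq_zero, Prod.mk_zero_zero])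
    (by
      simp only [HasGenus, Nat.card_eq_fintype_card] at hT
      simp only [Module.finrank_prod, Module.finrank_fintype_fun_eq_card,
        Fintype.card_fin, Module.finrank_self]
      omega) (r, q, s, t)
    (by
      change (totalSum T.Face r, totalSum T.Vertex q) = 0
      rw [totalSum_apply, totalSum_apply, hr, hq, Prod.mk_zero_zero])
  simp only [hf, Prod.mk.injEq] at hc
  refine ⟨T.orientedForm c, ⟨T.isAbelianDifferential_orientedForm c, hc⟩, ?_⟩
  rintro ω ⟨hω, h1, h2, h3, h4⟩
  rw [← sub_eq_zero]
  apply uniq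
  · intro e
    simp only [Pi.sub_apply, hω e, T.isAbelianDifferential_orientedForm c e]
    ring
  · rw [map_sub, h1, hc.1, sub_self]
  · rw [map_sub, map_sub, h2, hc.2.1, sub_self]
  · rw [map_sub, h3, hc.2.2.1, sub_self]
  · rw [map_sub, map_sub, h4, hc.2.2.2, sub_self]

/-! ### Passage to complex residues -/

variable (T)

theorem faceResidue_eq [Fintype D] (ω : D → ℝ) (f : T.Face) :
    T.faceResidue ω f = (fiberSum T.left ω f : ℝ) := rfl

theorem vertexResidue_eq [Fintype D] (ω : D → ℝ) (y : T.Vertex) :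
    T.vertexResidue ω y = Complex.I * (fiberSum T.head (T.star ω) y : ℝ) := rfl

end PolyhedralSurface

theorem mainTheorem11 {D : Type*} [Fintype D] (T : PolyhedralSurface D)
    (g : ℕ) (hg : 1 ≤ g) (hT : T.HasGenus g)
    (x : T.Vertex) (α β : Fin g → List D) (hαβ : T.IsStandardBasis x α β)
    (γ : Fin g → List D) (hγ_closed : ∀ k, ∃ f : T.Face, T.IsChain f (γ k) f)
    (hγ : ∀ k, T.ChainHomotopic x (γ k) (α k))
    (z w : T.Vertex) (hzw : z ≠ w) :
    ∃! ω : D → ℝ, T.IsAbelianDifferential ω ∧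
      T.vertexResidue ω z = Complex.I ∧ T.vertexResidue ω w = -Complex.I ∧
      (∀ y : T.Vertex, y ≠ z → y ≠ w → T.vertexResidue ω y = 0) ∧
      (∀ f : T.Face, T.faceResidue ω f = 0) ∧
      (∀ k, PolyhedralSurface.pathIntegral ω (α k) = 0) ∧
      (∀ k, T.chainIntegral ω (γ k) = 0) := by
  classical
  have : Fintype T.Vertex := Fintype.ofFinite _
  have : Fintype T.Face := Fintype.ofFinite _
  have key := hαβ.existsUnique_isAbelianDifferential hg hT hγ 0 (by simp)
    (Pi.single z 1 - Pi.single w 1) (by simp) 0 0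
  refine (existsUnique_congr fun ω => ?_).1 key
  refine and_congr_right fun _ => ?_
  have hface : fiberSum T.left ω = 0 ↔ ∀ f, T.faceResidue ω f = 0 := by
    simp [funext_iff, T.faceResidue_eq]
  have hvertex : fiberSum T.head (T.star ω) = Pi.single z 1 - Pi.single w 1 ↔
      T.vertexResidue ω z = Complex.I ∧ T.vertexResidue ω w = -Complex.I ∧
        ∀ y : T.Vertex, y ≠ z → y ≠ w → T.vertexResidue ω y = 0 := by
    have h1 : ∀ r : ℝ, Complex.I * r = Complex.I ↔ r = 1 := fun r => by
      rw [mul_eq_left₀ Complex.I_ne_zero, Complex.ofReal_eq_one]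
    have h2 : ∀ r : ℝ, Complex.I * r = -Complex.I ↔ r = -1 := fun r => by
      rw [← mul_neg_one, mul_right_inj' Complex.I_ne_zero]
      norm_cast
    simp only [T.vertexResidue_eq, h1, h2, mul_eq_zero, Complex.I_ne_zero, false_or,
      Complex.ofReal_eq_zero]
    constructor
    · intro h
      rw [h]
      refine ⟨by simp [hzw], by simp [hzw.symm], fun y hyz hyw => by simp [hyz, hyw]⟩
    · rintro ⟨hz, hw, h⟩
      ext y
      by_cases hyz : y = z
      · subst hyz
        simp [hz, hzw]
      by_cases hyw : y = w
      · subst hyw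
        simp [hw, hyz]
      simp [h y hyz hyw, hyz, hyw]
  rw [hface, hvertex, funext_iff, funext_iff]
  exact ⟨fun ⟨h1, ⟨h2, h3, h4⟩, h5, h6⟩ => ⟨h2, h3, h4, h1, h5, h6⟩,
    fun ⟨h2, h3, h4, h1, h5, h6⟩ => ⟨h1, ⟨h2, h3, h4⟩, h5, h6⟩⟩
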